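/- **Conventions.** Let $K=\mathbb R\{\{t\}\}$ be the field of real Puiseux series, $\operatorname{val}(a)$ the lowest exponent of $t$ in $a\in K^*$, and order $K$ by: $a>0$ iff the coefficient of $t^{\operatorname{val}(a)}$ is positive; let $s(a)\in\{\pm1\}$ be the sign of $a\in K^*$. Put $\operatorname{trop}_{\mathbb R}(a)=(s(a),-\operatorname{val}(a))\in\{\pm1\}\times\mathbb R$. For an ideal $I\subset K[x_1^{\pm1},\dots,x_n^{\pm1}]$ with variety $V(I)\subset (K^*)^n$, let $\operatorname{trop}_{\mathbb R}(V(I))$ be the closure of $\{(\operatorname{trop}_{\mathbb R}(x_1),\dots,\operatorname{trop}_{\mathbb R}(x_n)) : x\in V(I)\}$ in $(\{\pm1\}\times\mathbb R)^n$. A pure sign vector is an $s\in\{+,-\}^n$; its chart is $s\times\mathbb R^n\subset(\{\pm1\}\times\mathbb R)^n$, identified with $\mathbb R^n$. The ideal $I$ is *linear* if it is generated by linear forms $\sum_j a_jx_j$. The *circuit forms* of $I$ are the nonzero linear forms in $I$ of inclusion-minimal support, and the oriented matroid $M$ of $I$ is the one on $\{1,\dots,n\}$ whose signed circuits are the sign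 vectors of the coefficient vectors of the circuit forms. The linear ideal $I$ has *constant coefficients* if it has a generating set of linear forms all of whose nonzero coefficients have valuation $0$ and which contains a nonzero scalar multiple of every circuit form of $I$. (This holds in particular whenever $I$ is generated by linear forms with coefficients in $\mathbb R$.) For sign vectors $a,b\in\{+,-,0\}^n$ write $a\subseteq b$ if $a^+\subseteq b^+$ and $a^-\subseteq b^-$. For $w\in\mathbb R^n$ and a signed circuit $C$ of $M$, the initial circuit $\operatorname{in}_w C$ consists of the elements of $C$, with their signs, at which $w$ attains its maximum over the support of $C$; the signed circuits of the initial oriented matroid $M_w$ are the inclusion-minimal ones among the $\operatorname{in}_wC$. For a pure sign vector $s$, $M_w$ is *$s$-acyclic* if none of its signed circuits $C'$ satisfies $C'\subseteq s$, and the *signed Bergman fan* is $\mathcal B_s(M)=\{w\in\mathbb R^n : M_w \text{ is } s\text{-acyclic}\}$. **Theorem.** Let $I\subset K[x_1^{\pm1},\dots,x_n^{\pm1}]$ be a linear ideal with constant coefficients and let $M$ be its oriented matroid. Then for every pure sign vector $s\in\{+,-\}^n$, $$\operatorname{trop}_{\mathbb R}(V(I))\cap\bigl(s\times\mathbb R^n\bigr)=s\times\mathcal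 B_s(M).$$ -/

import Mathlib

noncomputable section

namespace RealTropical

/-! ### Real Puiseux series -/

/-- The field of real Puiseux series: formal series `∑ a_q t^q` with real coefficients, whose
exponents lie in `(1/N)ℤ` for some positive integer `N` and are bounded below (a well-ordered
subset of `(1/N)ℤ` is the same thing as one that is bounded below).  It is realised inside the
field of Hahn series; `Lex` selects the order of that field in which `f` is positive iff its
leading coefficient (the coefficient of the lowest power of `t`) is positive. -/
def realPuiseux : Subfield (Lex (HahnSeries ℚ ℝ)) where
  carrier := {f | ∃ N : ℕ, 0 < N ∧ ∀ q : ℚ, (ofLex f).coeff q ≠ 0 → ∃ k : ℤ, q = k / N}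
  mul_mem' := by
    rintro f g ⟨N, hN, hf⟩ ⟨N', hN', hg⟩
    refine ⟨N * N', Nat.mul_pos hN hN', fun q hq => ?_⟩
    obtain ⟨a, ha, b, hb, rfl⟩ := HahnSeries.support_mul_subset (x := ofLex f) (y := ofLex g)
      (show q ∈ (ofLex f * ofLex g).support from hq)
    obtain ⟨k, rfl⟩ := hf a ha
    obtain ⟨l, rfl⟩ := hg b hb
    refine ⟨k * N' + l * N, ?_⟩
    have h1 : (N : ℚ) ≠ 0 := by positivity
    have h2 : (N' : ℚ) ≠ 0 := by positivity
    push_cast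
    field_simp
  one_mem' := by
    refine ⟨1, one_pos, fun q hq => ⟨0, ?_⟩⟩
    by_contra h
    apply hq
    change (1 : HahnSeries ℚ ℝ).coeff q = 0
    simp only [Int.cast_zero, zero_div] at h
    simp [HahnSeries.coeff_one, h]
  add_mem' := by
    rintro f g ⟨N, hN, hf⟩ ⟨N', hN', hg⟩
    refine ⟨N * N', Nat.mul_pos hN hN', fun q hq => ?_⟩
    have h1 : (N : ℚ) ≠ 0 := by positivity
    have h2 : (N' : ℚ) ≠ 0 := by positivity
    by_cases h : (ofLex f).coeff q = 0
    · have h' : (ofLex g).coeff q ≠ 0 := by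
        intro h'
        apply hq
        change (ofLex f).coeff q + (ofLex g).coeff q = 0
        rw [h, h', add_zero]
      obtain ⟨k, rfl⟩ := hg q h'
      refine ⟨k * N, ?_⟩
      push_cast
      field_simp
    · obtain ⟨k, rfl⟩ := hf q h
      refine ⟨k * N', ?_⟩
      push_cast
      field_simp
  zero_mem' := ⟨1, one_pos, fun q hq => (hq rfl).elim⟩
  neg_mem' := by
    rintro f ⟨N, hN, hf⟩
    refine ⟨N, hN, fun q hq => hf q fun h => hq ?_⟩
    change -(ofLex f).coeff q = 0
    rw [h, neg_zero]
  inv_mem' := by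
    rintro f ⟨N, hN, hf⟩
    have h1 : (0 : ℚ) < N := by positivity
    let φ : ℤ →+ ℚ := (AddMonoidHom.mulRight ((N : ℚ)⁻¹)).comp (Int.castAddHom ℚ)
    have hφ : ∀ k : ℤ, φ k = k / N := fun k => rfl
    have hle : ∀ k l : ℤ, φ k ≤ φ l ↔ k ≤ l := by
      intro k l
      rw [hφ, hφ, div_le_div_iff_of_pos_right h1, Int.cast_le]
    have hinj : Function.Injective φ := by
      intro k l h
      exact le_antisymm ((hle k l).1 h.le) ((hle l k).1 h.ge)
    let e : ℤ ↪o ℚ := ⟨⟨φ, hinj⟩, hle _ _⟩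
    let E : HahnSeries ℤ ℝ →+* HahnSeries ℚ ℝ := HahnSeries.embDomainRingHom φ hinj hle
    have hE : ∀ x, E x = HahnSeries.embDomain e x := fun x => rfl
    have hpwo : (Function.support fun k : ℤ => (ofLex f).coeff (φ k)).IsPWO := by
      intro u
      obtain ⟨a, b, hab, hg⟩ := (ofLex f).isPWO_support (fun i => ⟨φ (u i), (u i).2⟩)
      exact ⟨a, b, hab, (hle _ _).1 hg⟩
    let x : HahnSeries ℤ ℝ := ⟨fun k => (ofLex f).coeff (φ k), hpwo⟩
    have hx : E x = ofLex f := by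
      ext q
      rw [hE]
      by_cases hq : (ofLex f).coeff q = 0
      · by_cases hr : q ∈ Set.range e
        · obtain ⟨k, rfl⟩ := hr
          rw [HahnSeries.embDomain_coeff]
          rfl
        · rw [HahnSeries.embDomain_of_notMem_range hr, hq]
      · obtain ⟨k, rfl⟩ := hf q hq
        have : (k / N : ℚ) = e k := rfl
        rw [this, HahnSeries.embDomain_coeff]
        rfl
    refine ⟨N, hN, fun q hq => ?_⟩
    have hinv : ofLex f⁻¹ = E x⁻¹ := by
      rw [map_inv₀ E, hx]
      rfl
    rw [hinv, hE] at hq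
    by_contra h
    refine hq (HahnSeries.embDomain_of_notMem_range ?_)
    rintro ⟨k, rfl⟩
    exact h ⟨k, rfl⟩

/-- The ordered field of real Puiseux series. -/
abbrev RealPuiseux : Type := realPuiseux

/-- The valuation: the lowest exponent of `t` that occurs in `a` (used for `a ≠ 0` only). -/
def val (a : RealPuiseux) : ℝ := ((ofLex (a : Lex (HahnSeries ℚ ℝ))).order : ℝ)

/-- The sign of a nonzero real Puiseux series. -/
def sgn (a : RealPuiseuxˣ) : ℤˣ := if 0 < (a : RealPuiseux) then 1 else -1

/-! ### Real tropicalization -/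

/-- The real tropical group `{1, -1} × ℝ` as a space (`ℤˣ = {1, -1}` is discrete);
the first component of an element is its sign, the second one its modulus. -/
abbrev RealTropicalGroup : Type := ℤˣ × ℝ

/-- The real tropicalization map `x ↦ (s(x), -val(x))`. -/
def realTrop (x : RealPuiseuxˣ) : RealTropicalGroup := (sgn x, -val x)

/-- The Laurent polynomial ring in `n` variables over the real Puiseux series. -/
abbrev LaurentRing (n : ℕ) : Type := AddMonoidAlgebra RealPuiseux (Fin n → ℤ)

/-- Evaluation of Laurent monomials at a point of the torus: `α ↦ ∏ j, x_j ^ α_j`. -/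
def evalMonomial {n : ℕ} (x : Fin n → RealPuiseuxˣ) :
    Multiplicative (Fin n → ℤ) →* RealPuiseux where
  toFun α := ((∏ j, x j ^ (α.toAdd j) : RealPuiseuxˣ) : RealPuiseux)
  map_one' := by simp
  map_mul' α β := by
    rw [← Units.val_mul, ← Finset.prod_mul_distrib]
    simp [zpow_add]

/-- Evaluation of Laurent polynomials at a point of the torus. -/
def evalAt {n : ℕ} (x : Fin n → RealPuiseuxˣ) : LaurentRing n →ₐ[RealPuiseux] RealPuiseux :=
  AddMonoidAlgebra.lift RealPuiseux RealPuiseux (Fin n → ℤ) (evalMonomial x)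

/-- The variety `V(I)` in the torus. -/
def variety {n : ℕ} (I : Ideal (LaurentRing n)) : Set (Fin n → RealPuiseuxˣ) :=
  {x | ∀ F ∈ I, evalAt x F = 0}

/-- The real tropicalization of a subset of the torus: the closure of its image under the
coordinatewise real tropicalization map. -/
def realTropicalization {n : ℕ} (X : Set (Fin n → RealPuiseuxˣ)) :
    Set (Fin n → RealTropicalGroup) :=
  closure ((fun x j => realTrop (x j)) '' X)

/-- The `s`-chart `s × ℝⁿ`, for a pure sign vector `s`. -/
def chart {n : ℕ} (s : Fin n → ℤˣ) : Set (Fin n → RealTropicalGroup) :=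
  {y | ∀ j, (y j).1 = s j}

/-- The identification of `ℝⁿ` with the `s`-chart. -/
def toChart {n : ℕ} (s : Fin n → ℤˣ) (w : Fin n → ℝ) : Fin n → RealTropicalGroup :=
  fun j => (s j, w j)

/-! ### Oriented matroids -/

/-- Sign vectors, identified with signed subsets `X` of `E`:
`X⁺`, `X⁻` and `X⁰` are the sets where the value is `1`, `-1` and `0`. -/
abbrev SignVector (E : Type) : Type := E → SignType

/-- The (pure) sign vector of a vector of signs `±1`. -/
def pureSignVector {n : ℕ} (s : Fin n → ℤˣ) : SignVector (Fin n) :=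
  fun j => SignType.sign ((s j : ℤˣ) : ℤ)

/-- The order on sign vectors: `a⁺ ⊆ b⁺` and `a⁻ ⊆ b⁻`. -/
def SignedSubset {E : Type} (a b : SignVector E) : Prop :=
  (∀ j, a j = 1 → b j = 1) ∧ (∀ j, a j = -1 → b j = -1)

/-- Oriented matroids on `E`, given by their signed circuits. -/
structure OrientedMatroid (E : Type) where
  circuits : Set (SignVector E)
  zero_notMem : (0 : SignVector E) ∉ circuits
  neg_mem : ∀ X ∈ circuits, -X ∈ circuits
  eq_or_eq_neg : ∀ X ∈ circuits, ∀ Y ∈ circuits,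
    Function.support X ⊆ Function.support Y → X = Y ∨ X = -Y
  elimination : ∀ X ∈ circuits, ∀ Y ∈ circuits, X ≠ -Y → ∀ e, X e = 1 → Y e = -1 →
    ∃ Z ∈ circuits, (∀ f, Z f = 1 → (X f = 1 ∨ Y f = 1) ∧ f ≠ e) ∧
      (∀ f, Z f = -1 → (X f = -1 ∨ Y f = -1) ∧ f ≠ e)

section Subspace

variable {F : Type} [Field F] {E : Type}

/-- The nonzero vectors of inclusion-minimal support of a linear subspace. -/
def IsElementary (W : Submodule F (E → F)) (a : E → F) : Prop :=
  a ∈ W ∧ a ≠ 0 ∧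
    ∀ b ∈ W, b ≠ 0 → Function.support b ⊆ Function.support a →
      Function.support a ⊆ Function.support b

theorem IsElementary.eq_smul {W : Submodule F (E → F)} {a b : E → F}
    (ha : IsElementary W a) (hb : b ∈ W) (hb0 : b ≠ 0)
    (h : Function.support b ⊆ Function.support a) : ∃ c : F, c ≠ 0 ∧ a = c • b := by
  obtain ⟨e, he⟩ := Function.ne_iff.1 hb0
  have he' : a e ≠ 0 := h he
  have he0 : b e ≠ 0 := he
  refine ⟨a e / b e, div_ne_zero he' he, ?_⟩
  by_contra hne
  have hs := ha.2.2 (a - (a e / b e) • b) (W.sub_mem ha.1 (W.smul_mem _ hb)) (sub_ne_zero.2 hne)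
    (by
      intro f hf
      by_contra hf0
      have h1 : a f = 0 := by simpa using hf0
      have h2 : b f = 0 := by
        by_contra h2
        exact h h2 h1
      apply hf
      simp [h1, h2]) he'
  apply hs
  simp [he0]

variable [LinearOrder F] [IsStrictOrderedRing F]

theorem exists_isElementary_conformal [Finite E] (W : Submodule F (E → F)) :
    ∀ (k : ℕ) (x : E → F), x ∈ W → x ≠ 0 → (Function.support x).ncard = k →
      ∃ z, IsElementary W z ∧ ∀ j, z j ≠ 0 → SignType.sign (z j) = SignType.sign (x j) := by
  intro k
  induction k using Nat.strong_induction_on with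
  | _ k ih =>
  intro x hx hx0 hk
  by_cases hel : IsElementary W x
  · exact ⟨x, hel, fun _ _ => rfl⟩
  obtain ⟨y, hy, hy0, hyx, hxy⟩ : ∃ y ∈ W, y ≠ 0 ∧
      Function.support y ⊆ Function.support x ∧ ¬ Function.support x ⊆ Function.support y := by
    by_contra! hcon
    exact hel ⟨hx, hx0, hcon⟩
  obtain ⟨y, hy, hyx, hxy, i, hi⟩ : ∃ y ∈ W, Function.support y ⊆ Function.support x ∧
      ¬ Function.support x ⊆ Function.support y ∧ ∃ i, 0 < x i * y i := by
    obtain ⟨i, hi⟩ := Function.ne_iff.1 hy0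
    have hxi : x i ≠ 0 := hyx hi
    rcases lt_or_gt_of_ne (mul_ne_zero hxi hi) with h | h
    · refine ⟨-y, W.neg_mem hy, ?_, ?_, i, ?_⟩
      · rwa [Function.support_neg]
      · rwa [Function.support_neg]
      · simpa using h
    · exact ⟨y, hy, hyx, hxy, i, h⟩
  obtain ⟨m, hm, hmin⟩ := Set.exists_min_image {j | 0 < x j * y j} (fun j => x j / y j)
    (Set.toFinite _) ⟨i, hi⟩
  have hm' : 0 < x m * y m := hm
  have hym : y m ≠ 0 := (mul_ne_zero_iff.1 hm'.ne').2
  set t := x m / y m with ht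
  have htpos : 0 < t := by
    rw [ht]
    rcases mul_pos_iff.1 hm' with ⟨h1, h2⟩ | ⟨h1, h2⟩
    · exact div_pos h1 h2
    · exact div_pos_of_neg_of_neg h1 h2
  have key : ∀ j, x j - t * y j ≠ 0 →
      SignType.sign (x j - t * y j) = SignType.sign (x j) := by
    intro j hj
    rcases lt_trichotomy (x j) 0 with hxj | hxj | hxj
    · rw [sign_neg hxj, sign_neg]
      refine lt_of_le_of_ne ?_ hj
      rcases lt_or_ge (y j) 0 with hyj | hyj
      · have := hmin j (mul_pos_of_neg_of_neg hxj hyj)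
        change x m / y m ≤ x j / y j at this
        rw [← ht] at this
        rw [le_div_iff_of_neg hyj] at this
        linarith
      · nlinarith [mul_nonneg htpos.le hyj]
    · have : y j = 0 := by
        by_contra h
        exact hyx h hxj
      simp [hxj, this] at hj
    · rw [sign_pos hxj, sign_pos]
      refine lt_of_le_of_ne ?_ (Ne.symm hj)
      rcases lt_or_ge 0 (y j) with hyj | hyj
      · have := hmin j (mul_pos hxj hyj)
        change x m / y m ≤ x j / y j at this
        rw [← ht] at this
        rw [le_div_iff₀ hyj] at this
        linarith
      · nlinarith [mul_nonneg htpos.le (neg_nonneg.2 hyj)]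
  obtain ⟨p, hp, hp'⟩ := Set.not_subset.1 hxy
  have hyp : y p = 0 := by simpa using hp'
  have hne : x - t • y ≠ 0 := by
    intro h
    have := congrFun h p
    simp [hyp] at this
    exact hp this
  have hcard : (Function.support (x - t • y)).ncard < k := by
    rw [← hk]
    refine Set.ncard_lt_ncard ?_ (Set.toFinite _)
    refine ⟨fun j hj hxj => ?_, fun hsub => ?_⟩
    · have hyj : y j = 0 := by
        by_contra h
        exact hyx h hxj
      apply hj
      simp [hxj, hyj]
    · have hxm : x m ≠ 0 := (mul_ne_zero_iff.1 hm'.ne').1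
      apply hsub hxm
      simp [ht, hym]
  obtain ⟨z, hz, hzs⟩ := ih _ hcard (x - t • y) (W.sub_mem hx (W.smul_mem _ hy)) hne rfl
  refine ⟨z, hz, fun j hj => ?_⟩
  have h1 := hzs j hj
  rw [h1]
  refine key j fun h0 => ?_
  have : (x - t • y) j = 0 := h0
  rw [this, sign_zero, sign_eq_zero_iff] at h1
  exact hj h1

/-- The oriented matroid of a linear subspace `W` of `F^E` over an ordered field: its signed
circuits are the sign vectors of the nonzero vectors of `W` of minimal support. -/
def OrientedMatroid.ofSubspace [Finite E] (W : Submodule F (E → F)) : OrientedMatroid E where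
  circuits := {X | ∃ a, IsElementary W a ∧ X = fun j => SignType.sign (a j)}
  zero_notMem := by
    rintro ⟨a, ha, h⟩
    refine ha.2.1 (funext fun j => ?_)
    exact sign_eq_zero_iff.1 (congrFun h j).symm
  neg_mem := by
    rintro _ ⟨a, ha, rfl⟩
    refine ⟨-a, ⟨W.neg_mem ha.1, neg_ne_zero.2 ha.2.1, ?_⟩, ?_⟩
    · rw [Function.support_neg]
      exact ha.2.2
    · funext j
      simp [Left.sign_neg]
  eq_or_eq_neg := by
    rintro _ ⟨a, ha, rfl⟩ _ ⟨b, hb, rfl⟩ h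
    have h' : Function.support a ⊆ Function.support b := by
      intro j hj hbj
      exact h (a := j) (by simpa using hj) (by simp [hbj])
    obtain ⟨c, hc, rfl⟩ := hb.eq_smul ha.1 ha.2.1 h'
    rcases lt_or_gt_of_ne hc with hc | hc
    · right
      funext j
      simp [sign_mul, sign_neg hc]
    · left
      funext j
      simp [sign_mul, sign_pos hc]
  elimination := by
    rintro _ ⟨a, ha, rfl⟩ _ ⟨b, hb, rfl⟩ hne e he1 he2
    have hae : 0 < a e := sign_eq_one_iff.1 he1
    have hbe : b e < 0 := sign_eq_neg_one_iff.1 he2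
    have hv0 : (-b e) • a + a e • b ≠ 0 := by
      intro h0
      apply hne
      funext j
      have hj : -b e * a j + a e * b j = 0 := congrFun h0 j
      have hj' : a j = -((a e / -b e) * b j) := by
        have hbe' : -b e ≠ 0 := (neg_pos.2 hbe).ne'
        rw [div_mul_eq_mul_div, eq_comm, neg_eq_iff_eq_neg, div_eq_iff hbe']
        linarith
      change SignType.sign (a j) = -SignType.sign (b j)
      rw [hj', Left.sign_neg, sign_mul, sign_pos (div_pos hae (neg_pos.2 hbe)), one_mul]
    obtain ⟨z, hz, hzs⟩ := exists_isElementary_conformal W _ _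
      (W.add_mem (W.smul_mem (-b e) ha.1) (W.smul_mem (a e) hb.1)) hv0 rfl
    have hze : z e = 0 := by
      by_contra h
      have h1 := hzs e h
      have h2 : ((-b e) • a + a e • b) e = 0 := by
        simp
        ring
      rw [h2, sign_zero, sign_eq_zero_iff] at h1
      exact h h1
    refine ⟨_, ⟨z, hz, rfl⟩, fun f hf => ⟨?_, ?_⟩, fun f hf => ⟨?_, ?_⟩⟩
    · have hzf : z f ≠ 0 := (sign_eq_one_iff.1 hf).ne'
      have h1 := hzs f hzf
      rw [hf] at h1
      have h2 : 0 < -b e * a f + a e * b f := sign_eq_one_iff.1 h1.symm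
      by_contra! hcon
      have h3 : a f ≤ 0 := not_lt.1 fun h => hcon.1 (sign_pos h)
      have h4 : b f ≤ 0 := not_lt.1 fun h => hcon.2 (sign_pos h)
      nlinarith [mul_nonneg hae.le (neg_nonneg.2 h4),
        mul_nonneg (neg_pos.2 hbe).le (neg_nonneg.2 h3)]
    · rintro rfl
      simp [hze] at hf
    · have hzf : z f ≠ 0 := (sign_eq_neg_one_iff.1 hf).ne
      have h1 := hzs f hzf
      rw [hf] at h1
      have h2 : -b e * a f + a e * b f < 0 := sign_eq_neg_one_iff.1 h1.symm
      by_contra! hcon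
      have h3 : 0 ≤ a f := not_lt.1 fun h => hcon.1 (sign_neg h)
      have h4 : 0 ≤ b f := not_lt.1 fun h => hcon.2 (sign_neg h)
      nlinarith [mul_nonneg hae.le h4, mul_nonneg (neg_pos.2 hbe).le h3]
    · rintro rfl
      simp [hze] at hf

end Subspace

/-! ### Signed Bergman fans -/

open Classical in
/-- The signed initial circuit `in_w C`: the elements of `C` at which `w` is maximal on the
support of `C`, with their signs. -/
def initialCircuit {E : Type} (w : E → ℝ) (C : SignVector E) : SignVector E :=
  fun j => if ∀ i, C i ≠ 0 → w i ≤ w j then C j else 0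

/-- The signed circuits of the initial oriented matroid `M_w`: the inclusion-minimal ones among
the `in_w C`, for `C` a signed circuit of `M`. -/
def initialCircuits {E : Type} (M : OrientedMatroid E) (w : E → ℝ) : Set (SignVector E) :=
  {X | X ∈ initialCircuit w '' M.circuits ∧
    ∀ Y ∈ initialCircuit w '' M.circuits,
      Function.support Y ⊆ Function.support X → Function.support X ⊆ Function.support Y}

/-- An oriented matroid with set of signed circuits `𝒞` is `s`-acyclic if no signed circuit is
contained in `s`. -/
def IsSAcyclic {E : Type} (𝒞 : Set (SignVector E)) (s : SignVector E) : Prop :=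
  ¬ ∃ C ∈ 𝒞, SignedSubset C s

/-- The signed Bergman fan `B_s(M) = {w ∈ ℝⁿ | M_w is s-acyclic}`. -/
def signedBergmanFan {n : ℕ} (s : Fin n → ℤˣ) (M : OrientedMatroid (Fin n)) :
    Set (Fin n → ℝ) :=
  {w | IsSAcyclic (initialCircuits M w) (pureSignVector s)}

/-! ### Linear ideals -/

/-- The linear form `∑ j, a_j x_j`. -/
def linearForm {n : ℕ} : (Fin n → RealPuiseux) →ₗ[RealPuiseux] LaurentRing n :=
  Fintype.linearCombination RealPuiseux
    fun j => AddMonoidAlgebra.single (Pi.single j (1 : ℤ) : Fin n → ℤ) (1 : RealPuiseux)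

/-- The coefficient vectors of the linear forms that lie in `I`. -/
def linearForms {n : ℕ} (I : Ideal (LaurentRing n)) :
    Submodule RealPuiseux (Fin n → RealPuiseux) :=
  (I.restrictScalars RealPuiseux).comap linearForm

/-- Linear ideals: ideals of the Laurent polynomial ring generated by linear forms. -/
def IsLinearIdeal {n : ℕ} (I : Ideal (LaurentRing n)) : Prop :=
  ∃ G : Set (Fin n → RealPuiseux), I = Ideal.span (linearForm '' G)

/-- The oriented matroid associated to a linear ideal: its signed circuits are the sign vectors of
the nonzero linear forms of minimal support in the ideal. -/
def idealMatroid {n : ℕ} (I : Ideal (LaurentRing n)) : OrientedMatroid (Fin n) :=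
  OrientedMatroid.ofSubspace (linearForms I)

/-- `I` has constant coefficients: it is generated by a set of linear forms all of whose nonzero
coefficients have valuation zero, and up to scalars this set contains every linear form of `I`
that gives a signed circuit.  Without the last clause the notion would be too weak: in
`⟨x₁ + x₂ + x₃, x₁ + (1 + t) x₂ + 2 x₃⟩` all coefficients of the generators have valuation zero,
but the circuit `t x₂ + x₃` does not have constant valuation. -/
def HasConstantCoefficients {n : ℕ} (I : Ideal (LaurentRing n)) : Prop :=
  ∃ G : Set (Fin n → RealPuiseux), I = Ideal.span (linearForm '' G) ∧
    (∀ a ∈ G, ∀ j, a j ≠ 0 → val (a j) = 0) ∧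
    ∀ a, IsElementary (linearForms I) a → ∃ c : RealPuiseux, c ≠ 0 ∧ c • a ∈ G

/-- A real number as a (constant) real Puiseux series. -/
def constSeries : ℝ →+* RealPuiseux where
  toFun r := ⟨toLex (HahnSeries.C r), 1, one_pos, fun q hq => ⟨0, by
    by_contra h
    simp only [Int.cast_zero, zero_div] at h
    apply hq
    rw [ofLex_toLex, HahnSeries.C_apply, HahnSeries.coeff_single_of_ne h]⟩⟩
  map_one' := Subtype.ext (congrArg toLex (map_one HahnSeries.C))
  map_mul' r s := Subtype.ext (congrArg toLex (map_mul HahnSeries.C r s))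
  map_zero' := Subtype.ext (congrArg toLex (map_zero HahnSeries.C))
  map_add' r s := Subtype.ext (congrArg toLex (map_add HahnSeries.C r s))

theorem val_constSeries (r : ℝ) : val (constSeries r) = 0 := by
  have h : (HahnSeries.C r : HahnSeries ℚ ℝ).order = 0 := HahnSeries.order_C
  exact (congrArg (fun q : ℚ => (q : ℝ)) h).trans Rat.cast_zero

theorem evalAt_linearForm {n : ℕ} (x : Fin n → RealPuiseuxˣ) (a : Fin n → RealPuiseux) :
    evalAt x (linearForm a) = ∑ j, a j * x j := by
  rw [linearForm, Fintype.linearCombination_apply, map_sum]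
  refine Finset.sum_congr rfl fun j _ => ?_
  rw [map_smul, evalAt, AddMonoidAlgebra.lift_single, one_smul, smul_eq_mul]
  congr 1
  change ((∏ i, x i ^ ((Pi.single j (1 : ℤ) : Fin n → ℤ) i) : RealPuiseuxˣ) : RealPuiseux) = x j
  rw [Finset.prod_eq_single j]
  · simp
  · intro i _ hi
    simp [hi]
  · simp

/-- Unless it contains a variable, a linear ideal contains no linear forms besides the linear
combinations of its generators. -/
theorem mem_span_of_linearForm_mem {n : ℕ} (G : Set (Fin n → RealPuiseux))
    (hG : ∀ j, linearForm (Pi.single j 1) ∉ Ideal.span (linearForm '' G))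
    {a : Fin n → RealPuiseux} (ha : linearForm a ∈ Ideal.span (linearForm '' G)) :
    a ∈ Submodule.span RealPuiseux G := by
  by_contra hna
  set W := Submodule.span RealPuiseux G
  have hW : ∀ v ∈ W, linearForm v ∈ Ideal.span (linearForm '' G) := by
    intro v hv
    have : W ≤ ((Ideal.span (linearForm '' G)).restrictScalars RealPuiseux).comap linearForm :=
      Submodule.span_le.2 fun g hg => Ideal.subset_span ⟨g, hg, rfl⟩
    exact this hv
  let v : Option (Fin n) → (Fin n → RealPuiseux) :=
    fun o => o.elim a fun j => Pi.single j 1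
  have hv : ∀ o, v o ∉ W := by
    rintro (_ | j)
    · exact hna
    · exact fun h => hG j (hW _ h)
  obtain ⟨φ, hφ, hφv⟩ := Module.Dual.exists_forall_mem_ne_zero_of_forall_exists
    W.dualAnnihilator
    (fun o => Module.Dual.eval RealPuiseux _ (v o)) (fun o => by
      obtain ⟨f, hf, hfW⟩ := Submodule.exists_le_ker_of_notMem (hv o)
      exact ⟨f, (Submodule.mem_dualAnnihilator f).2 fun w hw => hfW hw, hf⟩)
  let x : Fin n → RealPuiseuxˣ := fun j => Units.mk0 (φ (Pi.single j 1)) (hφv (some j))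
  have hx : ∀ b, evalAt x (linearForm b) = φ b := by
    intro b
    rw [evalAt_linearForm, LinearMap.pi_apply_eq_sum_univ φ b]
    refine Finset.sum_congr rfl fun j _ => ?_
    rw [smul_eq_mul]
    congr 1
    change φ (Pi.single j 1) = _
    congr 1
    funext i
    simp [Pi.single_apply, eq_comm]
  have hker : Ideal.span (linearForm '' G) ≤ RingHom.ker (evalAt x) := by
    rw [Ideal.span_le]
    rintro _ ⟨g, hg, rfl⟩
    change evalAt x (linearForm g) = 0
    rw [hx]
    exact (Submodule.mem_dualAnnihilator φ).1 hφ g (Submodule.subset_span hg)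
  have h0 : evalAt x (linearForm a) = 0 := hker ha
  rw [hx] at h0
  exact hφv none h0

/-- The standard example: ideals generated by linear forms with real coefficients have constant
coefficients. -/
theorem hasConstantCoefficients_of_real {n : ℕ} (H : Set (Fin n → ℝ)) :
    HasConstantCoefficients
      (Ideal.span (linearForm '' ((fun v j => constSeries (v j)) '' H)) :
        Ideal (LaurentRing n)) := by
  classical
  set G := (fun (v : Fin n → ℝ) j => constSeries (v j)) '' H with hG
  set I : Ideal (LaurentRing n) := Ideal.span (linearForm '' G) with hI
  refine ⟨{a | linearForm a ∈ I ∧ ∀ j, a j ≠ 0 → val (a j) = 0}, ?_, fun a ha => ha.2, ?_⟩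
  · refine le_antisymm (Ideal.span_mono (Set.image_mono ?_)) (Ideal.span_le.2 ?_)
    · rintro _ ⟨v, hv, rfl⟩
      exact ⟨Ideal.subset_span ⟨_, ⟨v, hv, rfl⟩, rfl⟩, fun j _ => val_constSeries _⟩
    · rintro _ ⟨a, ha, rfl⟩
      exact ha.1
  intro a ha
  suffices h : ∃ b : Fin n → ℝ, b ≠ 0 ∧ linearForm (fun j => constSeries (b j)) ∈ I ∧
      ∀ j, b j ≠ 0 → a j ≠ 0 by
    obtain ⟨b, hb0, hbI, hba⟩ := h
    obtain ⟨c, hc, hac⟩ := ha.eq_smul (b := fun j => constSeries (b j)) hbI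
      (fun h => hb0 (funext fun j => by
        by_contra hj
        exact hj ((map_eq_zero constSeries).1 (congrFun h j))))
      (fun j hj => hba j fun h => hj (by simp only [h, map_zero]))
    refine ⟨c⁻¹, inv_ne_zero hc, ?_⟩
    rw [hac, smul_smul, inv_mul_cancel₀ hc, one_smul]
    exact ⟨hbI, fun j _ => val_constSeries _⟩
  by_cases hcase : ∃ j, linearForm (Pi.single j 1) ∈ I
  · obtain ⟨j, hj⟩ := hcase
    have hunit : IsUnit (linearForm (Pi.single j 1) : LaurentRing n) := by
      refine IsUnit.of_mul_eq_one
        (AddMonoidAlgebra.single (-Pi.single j (1 : ℤ) : Fin n → ℤ) (1 : RealPuiseux)) ?_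
      rw [linearForm, Fintype.linearCombination_apply_single, one_smul,
        AddMonoidAlgebra.single_mul_single]
      simp [AddMonoidAlgebra.one_def]
    have htop : I = ⊤ := Ideal.eq_top_of_isUnit_mem I hj hunit
    obtain ⟨i, hi⟩ := Function.ne_iff.1 ha.2.1
    refine ⟨Pi.single i 1, by simp, by rw [htop]; trivial, fun k hk => ?_⟩
    have : k = i := by
      by_contra hki
      simp [hki] at hk
    rwa [this]
  · push Not at hcase
    have haW := mem_span_of_linearForm_mem G hcase ha.1
    obtain ⟨i, hi⟩ := Function.ne_iff.1 ha.2.1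
    have hi' : ofLex (a i).1 ≠ 0 := fun h => hi (Subtype.ext h)
    obtain ⟨q, hq⟩ : ∃ q, (ofLex (a i).1).coeff q ≠ 0 := by
      by_contra! h
      exact hi' (HahnSeries.ext (funext h))
    have hcoeff : ∀ q, linearForm (fun j => constSeries ((ofLex (a j).1).coeff q)) ∈ I := by
      intro q
      let cf : RealPuiseux →+ ℝ :=
        { toFun := fun f => (ofLex f.1).coeff q
          map_zero' := rfl
          map_add' := fun _ _ => rfl }
      have hcf : ∀ (f : RealPuiseux) (r : ℝ), cf (f * constSeries r) = cf f * r :=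
        fun f r => HahnSeries.coeff_mul_single_zero
      obtain ⟨k, f, g, rfl⟩ := Submodule.mem_span_set'.1 haW
      have hsum : (fun j => constSeries (cf ((∑ i, f i • (g i : Fin n → RealPuiseux)) j))) =
          ∑ i, constSeries (cf (f i)) • (g i : Fin n → RealPuiseux) := by
        funext j
        rw [Finset.sum_apply, Finset.sum_apply, map_sum, map_sum]
        refine Finset.sum_congr rfl fun i _ => ?_
        obtain ⟨v, -, hv⟩ := (g i).2
        rw [← hv, Pi.smul_apply, Pi.smul_apply, smul_eq_mul, smul_eq_mul, hcf, map_mul]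
      change linearForm (fun j => constSeries (cf _)) ∈ I
      rw [hsum, map_sum]
      refine I.sum_mem fun i _ => ?_
      rw [map_smul]
      exact Submodule.smul_of_tower_mem I _ (Ideal.subset_span ⟨_, (g i).2, rfl⟩)
    refine ⟨fun j => (ofLex (a j).1).coeff q, fun h => hq (congrFun h i), hcoeff q, ?_⟩
    intro j hj h
    apply hj
    simp only [h]
    rfl

end RealTropical

end

/-!
A linear ideal `I` with space `W` of linear forms has variety `W^⊥ ∩ (K^*)ⁿ`.  Real tropicalization
of `V(I)` is therefore a question about which signs and valuations occur in `W^⊥`.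

That the fan is necessary is the observation that the terms of lowest valuation in
`∑ j, a j * x j = 0` must cancel.  For a circuit form `a` of a constant coefficient ideal all
nonzero `a j` have the same valuation, so these terms are those of the initial circuit at
`w = -val x`, and they do not all have the same sign (`mem_signedBergmanFan_of_mem_variety`).  The
fan is closed and the chart is open, so nothing new arises in the closure.

For sufficiency, no reduction to the residue field is made.  Given `w` in the fan, take rational
`lo j < w j < hi j` close to `w j` and look for `x ∈ W^⊥` in the box given by the signs `s` and
`t ^ (-lo j) ≤ |x j| ≤ t ^ (-hi j)`.  Over any ordered field, a box meets `W^⊥` as soon as no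
elementary vector (nonzero vector of minimal support) of `W` is negative on the whole box
(`exists_orthogonal_mem_box`); here the relevant elementary vectors are the circuit forms.  The
criterion is a Farkas lemma with two ingredients: every vector is a conformal sum of elementary
vectors (`conformal_induction`), and up to scaling there are only finitely many of the latter, which
allows shrinking the sides of the box one at a time.  The condition on circuit forms holds because
by acyclicity some term of maximal weight has positive sign, and with `|x j| = t ^ (-hi j)` for this
term and `|x i| = t ^ (-lo i)` for the others it dominates (`exists_mem_variety_near`).

Both arguments use acyclicity as a statement on all initial circuits, whereas the definition only
speaks of the inclusion-minimal ones; `mem_signedBergmanFan_ofSubspace_iff` reconciles the two,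
again by conformal decomposition.
-/

namespace RealTropical

/-! ### Elementary vectors -/

section Field

variable {F : Type} [Field F] {E : Type}

theorem finite_isElementary_apply_eq [Finite E] (W : Submodule F (E → F)) (j : E) {c : F}
    (hc : c ≠ 0) : {a | IsElementary W a ∧ a j = c}.Finite := by
  refine Set.Finite.of_injOn (f := Function.support) (t := Set.univ) (fun _ _ => Set.mem_univ _)
    ?_ (Set.toFinite _)
  rintro a ⟨ha, haj⟩ b ⟨hb, hbj⟩ hab
  obtain ⟨d, -, hd⟩ := ha.eq_smul hb.1 hb.2.1 (Eq.ge hab)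
  have : c = d * c := by
    have := congrFun hd j
    rwa [Pi.smul_apply, smul_eq_mul, haj, hbj] at this
  have hd1 : d = 1 := (mul_eq_right₀ hc).1 this.symm
  rw [hd, hd1, one_smul]

theorem IsElementary.smul {W : Submodule F (E → F)} {a : E → F} (ha : IsElementary W a) {c : F}
    (hc : c ≠ 0) : IsElementary W (c • a) := by
  refine ⟨W.smul_mem _ ha.1, smul_ne_zero hc ha.2.1, fun b hb hb0 h => ?_⟩
  rw [Function.support_const_smul_of_ne_zero _ _ hc] at h ⊢
  exact ha.2.2 b hb hb0 h

end Field

/-! ### Conformal decomposition -/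

section OrderedField

variable {F : Type} [Field F] [LinearOrder F] [IsStrictOrderedRing F] {E : Type}

/-- Every vector of a linear subspace is a sum of elementary vectors without cancellation: a
property passes from the elementary vectors to all vectors as soon as it is inherited by sums
`x + y` in which `x` and `y` have no coordinate of opposite signs. -/
theorem conformal_induction [Finite E] (W : Submodule F (E → F)) {P : (E → F) → Prop}
    (zero : P 0) (elementary : ∀ z, IsElementary W z → P z)
    (add : ∀ x y, (∀ j, 0 ≤ x j * y j) → P x → P y → P (x + y)) :
    ∀ x ∈ W, P x := by
  suffices H : ∀ (k : ℕ) (x : E → F), x ∈ W → (Function.support x).ncard = k → P x from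
    fun x hx => H _ x hx rfl
  intro k
  induction k using Nat.strong_induction_on with
  | _ k ih =>
  intro x hx hk
  by_cases hx0 : x = 0
  · rwa [hx0]
  obtain ⟨z, hz, hzs⟩ := exists_isElementary_conformal W _ x hx hx0 rfl
  obtain ⟨i, hi⟩ := Function.ne_iff.1 hz.2.1
  obtain ⟨m, hm, hmin⟩ := Set.exists_min_image (Function.support z) (fun j => x j / z j)
    (Set.toFinite _) ⟨i, hi⟩
  have hpos : ∀ j, z j ≠ 0 → 0 < x j / z j := by
    intro j hj
    have h := hzs j hj
    rcases lt_or_gt_of_ne hj with hj' | hj'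
    · rw [sign_neg hj', eq_comm, sign_eq_neg_one_iff] at h
      exact div_pos_of_neg_of_neg h hj'
    · rw [sign_pos hj', eq_comm, sign_eq_one_iff] at h
      exact div_pos h hj'
  -- `t` is the largest multiple of `z` that can be split off from `x` conformally.
  set t := x m / z m with ht
  have htpos : 0 < t := hpos m hm
  have hel : IsElementary W (t • z) := hz.smul htpos.ne'
  have hcard : (Function.support (x - t • z)).ncard < k := by
    rw [← hk]
    refine Set.ncard_lt_ncard ⟨fun j hj hxj => hj ?_, fun hsub => ?_⟩ (Set.toFinite _)
    · have : z j = 0 := by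
        by_contra h
        exact (hpos j h).ne' (by rw [hxj, zero_div])
      simp [hxj, this]
    · have hm0 : z m ≠ 0 := hm
      have hxm : x m ≠ 0 := fun h => (hpos m hm).ne' (by rw [h, zero_div])
      apply hsub hxm
      simp [ht, hm0]
  have := add (t • z) (x - t • z) (fun j => ?_) (elementary _ hel)
    (ih _ hcard _ (W.sub_mem hx (W.smul_mem _ hz.1)) rfl)
  · simpa using this
  · by_cases hj : z j = 0
    · simp [hj]
    have h1 : 0 ≤ x j / z j - t := sub_nonneg.2 (hmin j hj)
    have h2 : (t • z) j * (x - t • z) j = t * (z j ^ 2 * (x j / z j - t)) := by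
      simp only [Pi.smul_apply, Pi.sub_apply, smul_eq_mul]
      field_simp
    rw [h2]
    positivity

/-- Every coordinate in the support of a vector of `W` is in the support of an elementary vector
that conforms to it. -/
theorem exists_isElementary_conformal_mem [Finite E] (W : Submodule F (E → F)) {x : E → F}
    (hx : x ∈ W) {e : E} (he : x e ≠ 0) :
    ∃ z, IsElementary W z ∧ z e ≠ 0 ∧
      ∀ j, z j ≠ 0 → SignType.sign (z j) = SignType.sign (x j) := by
  suffices H : ∀ x ∈ W, x e ≠ 0 → ∃ z, IsElementary W z ∧ z e ≠ 0 ∧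
      ∀ j, z j ≠ 0 → SignType.sign (z j) = SignType.sign (x j) from H x hx he
  refine conformal_induction W (fun h => absurd rfl h) (fun z hz he => ⟨z, hz, he, fun _ _ => rfl⟩)
    fun x y hxy ihx ihy he => ?_
  have key : ∀ a b : F, 0 ≤ a * b → a ≠ 0 → SignType.sign (a + b) = SignType.sign a := by
    intro a b hab ha
    rcases lt_or_gt_of_ne ha with ha | ha
    · rw [sign_neg ha, sign_neg]
      nlinarith [nonpos_of_mul_nonneg_right hab ha]
    · rw [sign_pos ha, sign_pos]
      nlinarith [nonneg_of_mul_nonneg_right hab ha]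
  have hne : ∀ a b : F, a ≠ 0 → SignType.sign a = SignType.sign b → b ≠ 0 := by
    rintro a b ha h rfl
    rw [sign_zero, sign_eq_zero_iff] at h
    exact ha h
  by_cases hxe : x e = 0
  · have hye : y e ≠ 0 := fun h => he (by simp [hxe, h])
    obtain ⟨z, hz, hze, hzs⟩ := ihy hye
    refine ⟨z, hz, hze, fun j hj => ?_⟩
    rw [hzs j hj, Pi.add_apply, add_comm,
      key _ _ (by rw [mul_comm]; exact hxy j) (hne _ _ hj (hzs j hj))]
  · obtain ⟨z, hz, hze, hzs⟩ := ihx hxe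
    refine ⟨z, hz, hze, fun j hj => ?_⟩
    rw [hzs j hj, Pi.add_apply, key _ _ (hxy j) (hne _ _ hj (hzs j hj))]

/-! ### Orthogonal vectors in a box -/

/-- The support function of the box `∏ j ∈ T, [l j, u j]`, which is the maximum of
`∑ j ∈ T, a j * x j` over all `x` in the box. -/
def boxSupport (T : Finset E) (l u a : E → F) : F := ∑ j ∈ T, max (a j * l j) (a j * u j)

theorem boxSupport_add_le (T : Finset E) (l u a b : E → F) :
    boxSupport T l u (a + b) ≤ boxSupport T l u a + boxSupport T l u b := by
  simp only [boxSupport, ← Finset.sum_add_distrib, Pi.add_apply, add_mul]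
  exact Finset.sum_le_sum fun j _ => max_add_add_le_max_add_max

theorem boxSupport_smul (T : Finset E) (l u a : E → F) {c : F} (hc : 0 ≤ c) :
    boxSupport T l u (c • a) = c * boxSupport T l u a := by
  simp only [boxSupport, Finset.mul_sum, Pi.smul_apply, smul_eq_mul, mul_assoc,
    mul_max_of_nonneg _ _ hc]

theorem sum_mul_le_boxSupport (T : Finset E) {l u x : E → F} (hx : ∀ j, l j ≤ x j ∧ x j ≤ u j)
    (a : E → F) : ∑ j ∈ T, a j * x j ≤ boxSupport T l u a := by
  refine Finset.sum_le_sum fun j _ => ?_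
  rcases le_total 0 (a j) with h | h
  · exact le_max_of_le_right (mul_le_mul_of_nonneg_left (hx j).2 h)
  · exact le_max_of_le_left (mul_le_mul_of_nonpos_left (hx j).1 h)

/-- The support function of a box is additive on conformal sums, so its nonnegativity on a subspace
need only be tested on elementary vectors. -/
theorem boxSupport_nonneg [Finite E] (W : Submodule F (E → F)) (T : Finset E) {l u : E → F}
    (hlu : ∀ j, l j ≤ u j) (h : ∀ a, IsElementary W a → 0 ≤ boxSupport T l u a) :
    ∀ a ∈ W, 0 ≤ boxSupport T l u a := by
  refine conformal_induction W (by simp [boxSupport]) h fun x y hxy hx hy => ?_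
  have : boxSupport T l u (x + y) = boxSupport T l u x + boxSupport T l u y := by
    rw [boxSupport, boxSupport, boxSupport, ← Finset.sum_add_distrib]
    refine Finset.sum_congr rfl fun j _ => ?_
    have hpos : ∀ c : F, 0 ≤ c → max (c * l j) (c * u j) = c * u j :=
      fun c hc => max_eq_right (mul_le_mul_of_nonneg_left (hlu j) hc)
    have hneg : ∀ c : F, c ≤ 0 → max (c * l j) (c * u j) = c * l j :=
      fun c hc => max_eq_left (mul_le_mul_of_nonpos_left (hlu j) hc)
    have := hxy j
    rw [Pi.add_apply]
    rcases mul_nonneg_iff.1 this with ⟨h1, h2⟩ | ⟨h1, h2⟩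
    · rw [hpos _ h1, hpos _ h2, hpos _ (add_nonneg h1 h2), add_mul]
    · rw [hneg _ h1, hneg _ h2, hneg _ (add_nonpos h1 h2), add_mul]
  rw [this]
  exact add_nonneg hx hy

/-- One side of the box can be shrunk to a point: the constraints on the position of this point
are given by finitely many elementary vectors, and any two of them are compatible. -/
theorem exists_shrink_box [Fintype E] [DecidableEq E] (W : Submodule F (E → F)) {l u : E → F}
    (hlu : ∀ j, l j ≤ u j)
    (h : ∀ a, IsElementary W a → 0 ≤ boxSupport Finset.univ l u a) (j : E) :
    ∃ c, l j ≤ c ∧ c ≤ u j ∧ ∀ a, IsElementary W a →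
      0 ≤ boxSupport Finset.univ (Function.update l j c) (Function.update u j c) a := by
  set g : (E → F) → F := boxSupport (Finset.univ.erase j) l u with hg
  have hsplit : ∀ a, boxSupport Finset.univ l u a = max (a j * l j) (a j * u j) + g a :=
    fun a => (Finset.add_sum_erase _ _ (Finset.mem_univ j)).symm
  have hsplit' : ∀ c a, boxSupport Finset.univ (Function.update l j c) (Function.update u j c) a =
      a j * c + g a := by
    intro c a
    rw [boxSupport, ← Finset.add_sum_erase _ _ (Finset.mem_univ j)]
    simp only [Function.update_self, max_self, hg, boxSupport]
    congr 1
    refine Finset.sum_congr rfl fun i hi => ?_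
    rw [Function.update_of_ne (Finset.ne_of_mem_erase hi),
      Function.update_of_ne (Finset.ne_of_mem_erase hi)]
  have hall := boxSupport_nonneg W Finset.univ hlu h
  -- The largest of the lower bounds for `c` is a valid choice.
  obtain ⟨c, hc, hmax⟩ := Set.exists_max_image
    (insert (l j) ((fun a => -g a) '' {a | IsElementary W a ∧ a j = 1})) id
    (((finite_isElementary_apply_eq W j one_ne_zero).image _).insert _) ⟨_, Set.mem_insert _ _⟩
  have hone : ∀ a, IsElementary W a → a j = 1 → -g a ≤ c := fun a ha haj =>
    hmax _ (Set.mem_insert_of_mem _ ⟨a, ⟨ha, haj⟩, rfl⟩)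
  have hneg : ∀ b, IsElementary W b → b j = -1 → c ≤ g b := by
    intro b hb hbj
    have h1 := h b hb
    rw [hsplit, hbj] at h1
    rcases hc with rfl | ⟨a, ⟨ha, haj⟩, rfl⟩
    · rw [max_eq_left (by linarith [hlu j])] at h1
      linarith
    · have h2 := hall _ (W.add_mem ha.1 hb.1)
      rw [hsplit, Pi.add_apply, haj, hbj] at h2
      have h3 := boxSupport_add_le (Finset.univ.erase j) l u a b
      rw [← hg] at h3
      simp only [add_neg_cancel, zero_mul, max_self, zero_add] at h2
      linarith
  refine ⟨c, hmax _ (Set.mem_insert _ _), ?_, fun a ha => ?_⟩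
  · rcases hc with rfl | ⟨a, ⟨ha, haj⟩, rfl⟩
    · exact hlu j
    · have h1 := h a ha
      rw [hsplit, haj, max_eq_right (by linarith [hlu j])] at h1
      linarith
  · rw [hsplit']
    rcases lt_trichotomy (a j) 0 with haj | haj | haj
    · have hp : 0 < (-a j)⁻¹ := inv_pos.2 (neg_pos.2 haj)
      have h1 := hneg _ (ha.smul hp.ne') (by
        rw [Pi.smul_apply, smul_eq_mul, inv_mul_eq_div, div_eq_iff (neg_pos.2 haj).ne']
        ring)
      rw [hg, boxSupport_smul _ _ _ _ hp.le, ← hg, inv_mul_eq_div, le_div_iff₀ (neg_pos.2 haj)] at h1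
      linarith
    · have h1 := h a ha
      rw [hsplit] at h1
      simpa [haj] using h1
    · have hp : 0 < (a j)⁻¹ := inv_pos.2 haj
      have h1 := hone _ (ha.smul hp.ne') (by
        rw [Pi.smul_apply, smul_eq_mul, inv_mul_cancel₀ haj.ne'])
      rw [hg, boxSupport_smul _ _ _ _ hp.le, ← hg, inv_mul_eq_div, neg_le_iff_add_nonneg,
        ← mul_le_mul_iff_right₀ haj] at h1
      rw [mul_zero, mul_add, mul_div_cancel₀ _ haj.ne'] at h1
      exact h1

/-- A box contains a vector orthogonal to `W` as soon as no elementary vector of `W` is negative on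
the whole box.  This holds over every ordered field, complete or not. -/
theorem exists_orthogonal_mem_box [Fintype E] (W : Submodule F (E → F)) (l u : E → F)
    (hlu : ∀ j, l j ≤ u j)
    (h : ∀ a, IsElementary W a → ∃ y : E → F, (∀ j, l j ≤ y j ∧ y j ≤ u j) ∧ 0 ≤ ∑ j, a j * y j) :
    ∃ x : E → F, (∀ j, l j ≤ x j ∧ x j ≤ u j) ∧ ∀ a ∈ W, ∑ j, a j * x j = 0 := by
  classical
  replace h : ∀ a, IsElementary W a → 0 ≤ boxSupport Finset.univ l u a := fun a ha => by
    obtain ⟨y, hy, hya⟩ := h a ha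
    exact hya.trans (sum_mul_le_boxSupport _ hy a)
  -- Shrink the sides one after the other until the box is a point.
  suffices H : ∀ T : Finset E, ∃ l' u' : E → F, (∀ j, l j ≤ l' j ∧ l' j ≤ u' j ∧ u' j ≤ u j) ∧
      (∀ j ∈ T, l' j = u' j) ∧ ∀ a, IsElementary W a → 0 ≤ boxSupport Finset.univ l' u' a by
    obtain ⟨x, x', hx, hxx', hnn⟩ := H Finset.univ
    obtain rfl : x = x' := funext fun j => hxx' j (Finset.mem_univ j)
    have hall := boxSupport_nonneg W Finset.univ (fun j => (hx j).2.1) hnn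
    refine ⟨x, fun j => ⟨(hx j).1, (hx j).2.2⟩, fun a ha => le_antisymm ?_ ?_⟩
    · simpa [boxSupport] using hall _ (W.neg_mem ha)
    · simpa [boxSupport] using hall _ ha
  intro T
  induction T using Finset.induction_on with
  | empty => exact ⟨l, u, fun j => ⟨le_rfl, hlu j, le_rfl⟩, by simp, h⟩
  | insert j T _ ih =>
    obtain ⟨l', u', hb, hT, hnn⟩ := ih
    obtain ⟨c, hlc, hcu, hc⟩ := exists_shrink_box W (fun j => (hb j).2.1) hnn j
    refine ⟨_, _, fun i => ?_, fun i hi => ?_, hc⟩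
    · by_cases hij : i = j
      · subst hij
        simpa using ⟨(hb i).1.trans hlc, hcu.trans (hb i).2.2⟩
      · simpa [hij] using hb i
    · by_cases hij : i = j
      · simp [hij]
      · simpa [hij] using hT i ((Finset.mem_insert.1 hi).resolve_left hij)

end OrderedField

/-! ### Initial circuits -/

section SignVector

variable {E : Type}

theorem signedSubset_iff {a b : SignVector E} :
    SignedSubset a b ↔ ∀ j, a j ≠ 0 → a j = b j := by
  constructor
  · intro h j hj
    rcases hcase : a j with _ | _ | _
    · exact absurd hcase hj
    · exact (h.2 j hcase).symm
    · exact (h.1 j hcase).symm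
  · intro h
    refine ⟨fun j hj => ?_, fun j hj => ?_⟩
    · rw [← h j (by rw [hj]; decide), hj]
    · rw [← h j (by rw [hj]; decide), hj]

theorem initialCircuit_ne_zero_iff {w : E → ℝ} {C : SignVector E} {j : E} :
    initialCircuit w C j ≠ 0 ↔ C j ≠ 0 ∧ ∀ i, C i ≠ 0 → w i ≤ w j := by
  rw [initialCircuit]
  split_ifs with h
  · exact ⟨fun hj => ⟨hj, h⟩, fun hj => hj.1⟩
  · exact ⟨fun hj => absurd rfl hj, fun hj => absurd hj.2 h⟩

theorem initialCircuit_apply_of_ne_zero {w : E → ℝ} {C : SignVector E} {j : E}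
    (h : initialCircuit w C j ≠ 0) : initialCircuit w C j = C j :=
  if_pos (initialCircuit_ne_zero_iff.1 h).2

theorem initialCircuit_neg (w : E → ℝ) (C : SignVector E) :
    initialCircuit w (-C) = -initialCircuit w C := by
  have h : ∀ a : SignType, -a ≠ 0 ↔ a ≠ 0 := by decide
  have h0 : (0 : SignType) = -0 := by decide
  funext j
  have hiff : (∀ i, (-C) i ≠ 0 → w i ≤ w j) ↔ ∀ i, C i ≠ 0 → w i ≤ w j :=
    forall_congr' fun i => imp_congr_left (h (C i))
  rw [Pi.neg_apply, initialCircuit, initialCircuit]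
  by_cases hj : ∀ i, C i ≠ 0 → w i ≤ w j
  · rw [if_pos hj, if_pos (hiff.2 hj), Pi.neg_apply]
  · rw [if_neg hj, if_neg (mt hiff.1 hj)]
    exact h0

theorem exists_initialCircuit_ne_zero [Finite E] (w : E → ℝ) {C : SignVector E} (hC : C ≠ 0) :
    ∃ j, initialCircuit w C j ≠ 0 := by
  obtain ⟨i, hi⟩ := Function.ne_iff.1 hC
  obtain ⟨m, hm, hmax⟩ := Set.exists_max_image (Function.support C) w (Set.toFinite _) ⟨i, hi⟩
  exact ⟨m, initialCircuit_ne_zero_iff.2 ⟨hm, hmax⟩⟩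

theorem initialCircuit_sign_ne_zero_iff {F : Type} [Field F] [LinearOrder F] {w : E → ℝ} {a : E → F} {j : E} :
    initialCircuit w (fun j => SignType.sign (a j)) j ≠ 0 ↔
      a j ≠ 0 ∧ ∀ i, a i ≠ 0 → w i ≤ w j := by
  simp [initialCircuit_ne_zero_iff, sign_eq_zero_iff]

end SignVector

section OrderedField

variable {F : Type} [Field F] [LinearOrder F] [IsStrictOrderedRing F] {E : Type}

/-- If the initial circuit of `a` contains a strictly smaller initial circuit, then it also contains
a strictly smaller one that conforms to it: eliminate an element of the initial circuit of `a`
without changing signs there, and take an elementary vector that conforms to the result and still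
has an element of maximal weight. -/
theorem exists_initialCircuit_conformal_ssubset [Finite E] (W : Submodule F (E → F)) (w : E → ℝ)
    {a y : E → F} (ha : IsElementary W a) (hy : IsElementary W y) {p : E}
    (hya : ∀ j, initialCircuit w (fun j => SignType.sign (y j)) j ≠ 0 →
      initialCircuit w (fun j => SignType.sign (a j)) j ≠ 0)
    (hpa : initialCircuit w (fun j => SignType.sign (a j)) p ≠ 0)
    (hpy : initialCircuit w (fun j => SignType.sign (y j)) p = 0) :
    ∃ d, IsElementary W d ∧
      SignedSubset (initialCircuit w fun j => SignType.sign (d j))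
        (initialCircuit w fun j => SignType.sign (a j)) ∧
      ∃ m, initialCircuit w (fun j => SignType.sign (a j)) m ≠ 0 ∧
        initialCircuit w (fun j => SignType.sign (d j)) m = 0 := by
  obtain ⟨i, hi⟩ := exists_initialCircuit_ne_zero w (C := fun j => SignType.sign (y j))
    (fun h => hy.2.1 (funext fun j => sign_eq_zero_iff.1 (congrFun h j)))
  -- Replacing `y` by `-y`, there is an element at which the initial circuits agree.
  obtain ⟨y, hyW, hya, hpy, i, hi, hpos⟩ : ∃ y ∈ W,
      (∀ j, initialCircuit w (fun j => SignType.sign (y j)) j ≠ 0 →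
        initialCircuit w (fun j => SignType.sign (a j)) j ≠ 0) ∧
      initialCircuit w (fun j => SignType.sign (y j)) p = 0 ∧
      ∃ i, initialCircuit w (fun j => SignType.sign (y j)) i ≠ 0 ∧ 0 < a i * y i := by
    have h1 := (initialCircuit_sign_ne_zero_iff.1 hi).1
    have h2 := (initialCircuit_sign_ne_zero_iff.1 (hya i hi)).1
    rcases lt_or_gt_of_ne (mul_ne_zero h2 h1) with h | h
    · have hsupp : ∀ j, initialCircuit w (fun j => SignType.sign ((-y) j)) j ≠ 0 ↔
          initialCircuit w (fun j => SignType.sign (y j)) j ≠ 0 := by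
        intro j
        simp only [initialCircuit_sign_ne_zero_iff, Pi.neg_apply, neg_ne_zero]
      exact ⟨-y, W.neg_mem hy.1, fun j hj => hya j ((hsupp j).1 hj),
        by_contra fun h' => (hsupp p).1 h' hpy, i, (hsupp i).2 hi, by simpa using h⟩
    · exact ⟨y, hy.1, hya, hpy, i, hi, h⟩
  -- The maximal weight is the same on the supports of `a` and `y`.
  have hpmax := (initialCircuit_sign_ne_zero_iff.1 hpa)
  have hwi : w i = w p :=
    le_antisymm (hpmax.2 i (initialCircuit_sign_ne_zero_iff.1 (hya i hi)).1)
      ((initialCircuit_sign_ne_zero_iff.1 (hya i hi)).2 p hpmax.1)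
  have hle_y : ∀ j, y j ≠ 0 → w j ≤ w p := fun j hj =>
    hwi ▸ (initialCircuit_sign_ne_zero_iff.1 hi).2 j hj
  have hin_y : ∀ j, w j = w p → y j ≠ 0 →
      initialCircuit w (fun j => SignType.sign (y j)) j ≠ 0 := fun j hj hyj =>
    initialCircuit_sign_ne_zero_iff.2 ⟨hyj, fun k hk => hj ▸ hle_y k hk⟩
  have hzero : ∀ j, w j = w p → a j = 0 → y j = 0 := fun j hj haj => by
    by_contra hyj
    exact (initialCircuit_sign_ne_zero_iff.1 (hya j (hin_y j hj hyj))).1 haj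
  have hyp : y p = 0 := by
    by_contra h
    exact hin_y p rfl h hpy
  obtain ⟨m, ⟨hmw, hm⟩, hmin⟩ := Set.exists_min_image {j | w j = w p ∧ 0 < a j * y j}
    (fun j => a j / y j) (Set.toFinite _) ⟨i, hwi, hpos⟩
  have hym : y m ≠ 0 := (mul_ne_zero_iff.1 hm.ne').2
  have ham : a m ≠ 0 := (mul_ne_zero_iff.1 hm.ne').1
  set t := a m / y m with ht
  have htpos : 0 < t := by
    rw [ht]
    rcases mul_pos_iff.1 hm with ⟨h1, h2⟩ | ⟨h1, h2⟩
    · exact div_pos h1 h2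
    · exact div_pos_of_neg_of_neg h1 h2
  have key : ∀ j, w j = w p → a j - t * y j ≠ 0 →
      SignType.sign (a j - t * y j) = SignType.sign (a j) := by
    intro j hj hj0
    rcases lt_trichotomy (a j) 0 with haj | haj | haj
    · rw [sign_neg haj, sign_neg]
      refine lt_of_le_of_ne ?_ hj0
      rcases lt_or_ge (y j) 0 with hyj | hyj
      · have := hmin j ⟨hj, mul_pos_of_neg_of_neg haj hyj⟩
        rw [le_div_iff_of_neg hyj] at this
        linarith
      · linarith [mul_nonneg htpos.le hyj]
    · simp [haj, hzero j hj haj] at hj0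
    · rw [sign_pos haj, sign_pos]
      refine lt_of_le_of_ne ?_ (Ne.symm hj0)
      rcases lt_or_ge 0 (y j) with hyj | hyj
      · have := hmin j ⟨hj, mul_pos haj hyj⟩
        rw [le_div_iff₀ hyj] at this
        linarith
      · linarith [mul_nonneg htpos.le (neg_nonneg.2 hyj)]
  obtain ⟨d, hd, hdp, hds⟩ := exists_isElementary_conformal_mem W
    (W.sub_mem ha.1 (W.smul_mem t hyW)) (e := p) (by simpa [hyp] using hpmax.1)
  have hdz : ∀ j, d j ≠ 0 → a j - t * y j ≠ 0 := by
    intro j hj h0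
    have h1 := hds j hj
    have h2 : (a - t • y) j = 0 := h0
    rw [h2, sign_zero, sign_eq_zero_iff] at h1
    exact hj h1
  have hin_d : ∀ j, initialCircuit w (fun j => SignType.sign (d j)) j ≠ 0 → w j = w p := by
    intro j hj
    obtain ⟨hdj, hmax⟩ := initialCircuit_sign_ne_zero_iff.1 hj
    refine le_antisymm ?_ (hmax p hdp)
    by_contra! hlt
    refine hdz j hdj ?_
    rw [by_contra fun h => hlt.not_ge (hpmax.2 j h), by_contra fun h => hlt.not_ge (hle_y j h)]
    simp
  refine ⟨d, hd, signedSubset_iff.2 fun j hj => ?_, m, ?_, ?_⟩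
  · have hj' := hin_d j hj
    have hdj := (initialCircuit_sign_ne_zero_iff.1 hj).1
    have haj : a j ≠ 0 := fun h => hdz j hdj (by simp [h, hzero j hj' h])
    rw [initialCircuit_apply_of_ne_zero hj, initialCircuit_apply_of_ne_zero
      (initialCircuit_sign_ne_zero_iff.2 ⟨haj, fun k hk => hj' ▸ hpmax.2 k hk⟩), hds j hdj]
    exact key j hj' (hdz j hdj)
  · exact initialCircuit_sign_ne_zero_iff.2 ⟨ham, fun k hk => hmw ▸ hpmax.2 k hk⟩
  · by_contra h
    exact hdz m (initialCircuit_sign_ne_zero_iff.1 h).1 (by rw [ht, div_mul_cancel₀ _ hym, sub_self])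

/-- In the definition of `s`-acyclicity of `M_w` the minimality of the initial circuits may be
dropped. -/
theorem mem_signedBergmanFan_ofSubspace_iff {n : ℕ} (W : Submodule F (Fin n → F))
    (s : Fin n → ℤˣ) (w : Fin n → ℝ) :
    w ∈ signedBergmanFan s (OrientedMatroid.ofSubspace W) ↔
      ∀ C ∈ (OrientedMatroid.ofSubspace W).circuits,
        ¬ SignedSubset (initialCircuit w C) (pureSignVector s) := by
  constructor
  · rintro hw _ ⟨a, ha, rfl⟩ has
    -- A conforming initial circuit of minimal cardinality is inclusion-minimal.
    suffices H : ∀ (k : ℕ) (a : Fin n → F), IsElementary W a →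
        SignedSubset (initialCircuit w fun j => SignType.sign (a j)) (pureSignVector s) →
        (Function.support (initialCircuit w fun j => SignType.sign (a j))).ncard = k → False from
      H _ a ha has rfl
    intro k
    induction k using Nat.strong_induction_on with
    | _ k ih =>
    intro a ha has hk
    refine hw ⟨_, ⟨⟨_, ⟨a, ha, rfl⟩, rfl⟩, ?_⟩, has⟩
    rintro _ ⟨_, ⟨y, hy, rfl⟩, rfl⟩ hya p hpa
    by_contra hpy
    obtain ⟨d, hd, hda, m, hma, hmd⟩ := exists_initialCircuit_conformal_ssubset W w ha hy
      (fun j hj => hya hj) hpa (by simpa using hpy)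
    rw [signedSubset_iff] at hda has
    have hsub : ∀ j, initialCircuit w (fun j => SignType.sign (d j)) j ≠ 0 →
        initialCircuit w (fun j => SignType.sign (a j)) j ≠ 0 := fun j hj => hda j hj ▸ hj
    refine ih _ ?_ d hd (signedSubset_iff.2 fun j hj => (hda j hj).trans (has j (hsub j hj))) rfl
    rw [← hk]
    exact Set.ncard_lt_ncard ⟨fun j hj => hsub j hj, fun h => h hma hmd⟩ (Set.toFinite _)
  · rintro h ⟨_, ⟨⟨C, hC, rfl⟩, -⟩, hCs⟩
    exact h C hC hCs

end OrderedField

theorem initialCircuit_ne_zero_of_eventually {E : Type} {w w' : E → ℝ}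
    (h : ∀ i j, w i < w j → w' i < w' j) {C : SignVector E} {j : E}
    (hj : initialCircuit w' C j ≠ 0) : initialCircuit w C j ≠ 0 := by
  rw [initialCircuit_ne_zero_iff] at hj ⊢
  exact ⟨hj.1, fun i hi => not_lt.1 fun hlt => (h _ _ hlt).not_ge (hj.2 i hi)⟩

theorem isClosed_signedBergmanFan_ofSubspace {F : Type} [Field F] [LinearOrder F]
    [IsStrictOrderedRing F] {n : ℕ} (W : Submodule F (Fin n → F)) (s : Fin n → ℤˣ) :
    IsClosed (signedBergmanFan s (OrientedMatroid.ofSubspace W)) := by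
  rw [← isOpen_compl_iff, isOpen_iff_mem_nhds]
  intro w hw
  rw [Set.mem_compl_iff, mem_signedBergmanFan_ofSubspace_iff] at hw
  push Not at hw
  obtain ⟨C, hC, hCs⟩ := hw
  -- Near `w` the strict inequalities between weights persist, so initial circuits can only shrink.
  have hev : ∀ᶠ w' in nhds w, ∀ i j, w i < w j → w' i < w' j := by
    simp only [Filter.eventually_all]
    exact fun i j hij =>
      (continuous_apply i).continuousAt.eventually_lt (continuous_apply j).continuousAt hij
  filter_upwards [hev] with w' hw'
  rw [Set.mem_compl_iff, mem_signedBergmanFan_ofSubspace_iff]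
  push Not
  rw [signedSubset_iff] at hCs
  refine ⟨C, hC, signedSubset_iff.2 fun j hj => ?_⟩
  have hj' := initialCircuit_ne_zero_of_eventually hw' hj
  rw [← hCs j hj', initialCircuit_apply_of_ne_zero hj, initialCircuit_apply_of_ne_zero hj']

/-! ### Valuation and order of Puiseux series -/

theorem val_mul {a b : RealPuiseux} (ha : a ≠ 0) (hb : b ≠ 0) : val (a * b) = val a + val b := by
  have ha' : ofLex (a : Lex (HahnSeries ℚ ℝ)) ≠ 0 := fun h => ha (Subtype.ext h)
  have hb' : ofLex (b : Lex (HahnSeries ℚ ℝ)) ≠ 0 := fun h => hb (Subtype.ext h)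
  rw [val, val, val, ← Rat.cast_add, ← HahnSeries.order_mul ha' hb']
  rfl

theorem coe_abs_realPuiseux (a : RealPuiseux) :
    ((|a| : RealPuiseux) : Lex (HahnSeries ℚ ℝ)) = |(a : Lex (HahnSeries ℚ ℝ))| := by
  rcases le_total 0 a with h | h
  · rw [abs_of_nonneg h, abs_of_nonneg (show (0 : Lex (HahnSeries ℚ ℝ)) ≤ a from h)]
  · rw [abs_of_nonpos h, abs_of_nonpos (show (a : Lex (HahnSeries ℚ ℝ)) ≤ 0 from h)]
    rfl

theorem val_abs (a : RealPuiseux) : val |a| = val a := by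
  rw [val, val, coe_abs_realPuiseux, HahnSeries.order_abs]

theorem abs_lt_abs_of_val_lt {a b : RealPuiseux} (ha : a ≠ 0) (hb : b ≠ 0) (h : val b < val a) :
    |a| < |b| := by
  have ha' : ofLex (a : Lex (HahnSeries ℚ ℝ)) ≠ 0 := fun h => ha (Subtype.ext h)
  have hb' : ofLex (b : Lex (HahnSeries ℚ ℝ)) ≠ 0 := fun h => hb (Subtype.ext h)
  change ((|a| : RealPuiseux) : Lex (HahnSeries ℚ ℝ)) < (|b| : RealPuiseux)
  rw [coe_abs_realPuiseux, coe_abs_realPuiseux]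
  refine HahnSeries.abs_lt_abs_of_orderTop_ofLex ?_
  rw [← HahnSeries.order_eq_orderTop_of_ne_zero ha', ← HahnSeries.order_eq_orderTop_of_ne_zero hb',
    WithTop.coe_lt_coe]
  exact Rat.cast_lt.1 h

theorem val_le_val_of_abs_le {a b : RealPuiseux} (ha : a ≠ 0) (hb : b ≠ 0) (h : |a| ≤ |b|) :
    val b ≤ val a :=
  not_lt.1 fun hlt => (abs_lt_abs_of_val_lt hb ha hlt).not_ge h

theorem natCast_mul_abs_lt {a b : RealPuiseux} (ha : a ≠ 0) (hb : b ≠ 0) (h : val b < val a)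
    (m : ℕ) : m * |a| < |b| := by
  rcases Nat.eq_zero_or_pos m with rfl | hm
  · simpa using hb
  have hm' : (m : RealPuiseux) ≠ 0 := Nat.cast_ne_zero.2 hm.ne'
  have hval : val (m : RealPuiseux) = 0 := by
    rw [← map_natCast constSeries, val_constSeries]
  have := abs_lt_abs_of_val_lt (mul_ne_zero hm' ha) hb (by rw [val_mul hm' ha, hval, zero_add]; exact h)
  rwa [abs_mul, Nat.abs_cast] at this

/-- A sum is positive if it has a positive term of smaller valuation than all negative terms. -/
theorem sum_pos_of_forall_neg_val_lt {ι : Type} [Fintype ι] (f : ι → RealPuiseux) {j : ι}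
    (hj : 0 < f j) (h : ∀ i, f i < 0 → val (f j) < val (f i)) : 0 < ∑ i, f i := by
  classical
  set T := Finset.univ.filter fun i => f i < 0 with hT
  have hc : (0 : RealPuiseux) < T.card + 1 := by positivity
  have h1 : ∀ i ∈ T, -(f j / (T.card + 1)) ≤ f i := by
    intro i hi
    have hi' : f i < 0 := (Finset.mem_filter.1 hi).2
    have := natCast_mul_abs_lt hi'.ne hj.ne' (h i hi') (T.card + 1)
    rw [abs_of_neg hi', abs_of_pos hj, Nat.cast_add, Nat.cast_one] at this
    rw [neg_le, le_div_iff₀ hc]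
    linarith
  have h2 := Finset.card_nsmul_le_sum T f _ h1
  rw [nsmul_eq_mul] at h2
  have h3 : f j ≤ ∑ i ∈ Finset.univ.filter (fun i => ¬ f i < 0), f i :=
    Finset.single_le_sum (fun i hi => not_lt.1 (Finset.mem_filter.1 hi).2)
      (Finset.mem_filter.2 ⟨Finset.mem_univ j, hj.not_gt⟩)
  rw [← Finset.sum_filter_add_sum_filter_not Finset.univ (fun i => f i < 0)]
  have h4 : (T.card : RealPuiseux) * -(f j / (T.card + 1)) + f j = f j / (T.card + 1) := by
    field_simp
    ring
  have h5 := div_pos hj hc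
  linarith

theorem exists_pos_val_eq (q : ℚ) : ∃ a : RealPuiseux, 0 < a ∧ val a = q := by
  refine ⟨⟨toLex (HahnSeries.single q 1), q.den, q.den_pos, fun r hr => ⟨q.num, ?_⟩⟩, ?_, ?_⟩
  · have : r = q := by
      by_contra h
      exact hr (HahnSeries.coeff_single_of_ne h)
    rw [this, Rat.num_div_den]
  · change (0 : Lex (HahnSeries ℚ ℝ)) < toLex (HahnSeries.single q 1)
    rw [← HahnSeries.leadingCoeff_pos_iff, ofLex_toLex, HahnSeries.leadingCoeff_of_single]
    exact one_pos
  · rw [val]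
    exact congrArg _ (HahnSeries.order_single one_ne_zero)

theorem sign_sgn (x : RealPuiseuxˣ) :
    SignType.sign ((sgn x : ℤˣ) : ℤ) = SignType.sign (x : RealPuiseux) := by
  rw [sgn]
  split_ifs with h
  · rw [sign_pos h]
    rfl
  · rw [sign_neg (lt_of_le_of_ne (not_lt.1 h) x.ne_zero)]
    rfl

/-! ### Linear ideals with constant coefficients -/

/-- With constant coefficients, all terms of a circuit form have the same valuation, as they do
after a suitable scaling. -/
theorem HasConstantCoefficients.exists_val_eq {n : ℕ} {I : Ideal (LaurentRing n)}
    (hI : HasConstantCoefficients I) {a : Fin n → RealPuiseux}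
    (ha : IsElementary (linearForms I) a) : ∃ v, ∀ j, a j ≠ 0 → val (a j) = v := by
  obtain ⟨G, -, hval, hcirc⟩ := hI
  obtain ⟨c, hc, hca⟩ := hcirc a ha
  refine ⟨-val c, fun j hj => ?_⟩
  have := hval _ hca j (mul_ne_zero hc hj)
  rw [Pi.smul_apply, smul_eq_mul, val_mul hc hj] at this
  linarith

theorem mem_variety_iff_of_isLinearIdeal {n : ℕ} {I : Ideal (LaurentRing n)}
    (hI : IsLinearIdeal I) (x : Fin n → RealPuiseuxˣ) :
    x ∈ variety I ↔ ∀ a ∈ linearForms I, ∑ j, a j * x j = 0 := by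
  refine ⟨fun hx a ha => (evalAt_linearForm x a).symm.trans (hx _ ha), fun h => ?_⟩
  obtain ⟨G, hG⟩ := hI
  have : I ≤ RingHom.ker (evalAt x) := by
    conv_lhs => rw [hG]
    rw [Ideal.span_le]
    rintro _ ⟨g, hg, rfl⟩
    refine (evalAt_linearForm x g).trans (h g ?_)
    change linearForm g ∈ I
    rw [hG]
    exact Ideal.subset_span ⟨g, hg, rfl⟩
  exact fun F hF => this hF

/-- The terms of maximal weight of a circuit form cannot cancel if they all have the same sign. -/
theorem mem_signedBergmanFan_of_mem_variety {n : ℕ} {I : Ideal (LaurentRing n)}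
    (hlin : IsLinearIdeal I) (hconst : HasConstantCoefficients I) {x : Fin n → RealPuiseuxˣ}
    (hx : x ∈ variety I) :
    (fun j => -val (x j)) ∈ signedBergmanFan (fun j => sgn (x j)) (idealMatroid I) := by
  rw [idealMatroid, mem_signedBergmanFan_ofSubspace_iff]
  rintro _ ⟨a, ha, rfl⟩ hs
  rw [signedSubset_iff] at hs
  obtain ⟨v, hv⟩ := hconst.exists_val_eq ha
  have hsign : ∀ j, initialCircuit (fun j => -val (x j)) (fun j => SignType.sign (a j)) j ≠ 0 →
      0 < a j * x j := by
    intro j hj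
    have h := hs j hj
    rw [initialCircuit_apply_of_ne_zero hj, pureSignVector, sign_sgn] at h
    rw [← sign_eq_one_iff, sign_mul, h, ← sign_mul, sign_eq_one_iff]
    exact mul_self_pos.2 (x j).ne_zero
  obtain ⟨j, hj⟩ := exists_initialCircuit_ne_zero (fun j => -val (x j))
    (C := fun j => SignType.sign (a j))
    (fun h => ha.2.1 (funext fun j => sign_eq_zero_iff.1 (congrFun h j)))
  have hj' := initialCircuit_sign_ne_zero_iff.1 hj
  refine (sum_pos_of_forall_neg_val_lt (fun i => a i * x i) (hsign j hj) fun i hi => ?_).ne'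
    ((mem_variety_iff_of_isLinearIdeal hlin x).1 hx a ha.1)
  have hai : a i ≠ 0 := left_ne_zero_of_mul hi.ne
  rw [val_mul hj'.1 (x j).ne_zero, val_mul hai (x i).ne_zero, hv j hj'.1, hv i hai]
  by_contra! hle
  refine hi.not_gt (hsign i (initialCircuit_sign_ne_zero_iff.2 ⟨hai, fun k hk => ?_⟩))
  have := hj'.2 k hk
  linarith

/-- Every point of the signed Bergman fan is approximated by points of the variety: look for them in
the box of all `x` with the given signs whose valuations are close to the given ones.  A circuit
form takes a nonnegative value on this box, since there is a term of maximal weight with positive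
sign, and it dominates once its variable is taken as large as the box permits and all others as
small as possible in absolute value. -/
theorem exists_mem_variety_near {n : ℕ} {I : Ideal (LaurentRing n)}
    (hlin : IsLinearIdeal I) (hconst : HasConstantCoefficients I) {s : Fin n → ℤˣ}
    {w : Fin n → ℝ} (hw : w ∈ signedBergmanFan s (idealMatroid I)) {ε : ℝ} (hε : 0 < ε) :
    ∃ x ∈ variety I, ∀ j, sgn (x j) = s j ∧ |-val (x j) - w j| < ε := by
  choose lo hlo using fun j => exists_rat_btwn (sub_lt_self (w j) hε)
  choose hi hhi using fun j => exists_rat_btwn (lt_add_of_pos_right (w j) hε)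
  choose A hA0 hA using fun j => exists_pos_val_eq (-lo j)
  choose B hB0 hB using fun j => exists_pos_val_eq (-hi j)
  have hAB : ∀ j, A j < B j := fun j => by
    have := abs_lt_abs_of_val_lt (hA0 j).ne' (hB0 j).ne' (by
      rw [hA, hB]
      push_cast
      linarith [(hlo j).2, (hhi j).1])
    rwa [abs_of_pos (hA0 j), abs_of_pos (hB0 j)] at this
  let l : Fin n → RealPuiseux := fun j => if s j = 1 then A j else -B j
  let u : Fin n → RealPuiseux := fun j => if s j = 1 then B j else -A j
  have hlu : ∀ j, l j ≤ u j := by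
    intro j
    simp only [l, u]
    split_ifs
    · exact (hAB j).le
    · exact neg_le_neg (hAB j).le
  -- Membership in a side of the box is a condition on sign and absolute value.
  have hbox : ∀ j (y : RealPuiseux), l j ≤ y ∧ y ≤ u j ↔
      SignType.sign y = pureSignVector s j ∧ A j ≤ |y| ∧ |y| ≤ B j := by
    intro j y
    simp only [l, u, pureSignVector]
    rcases Int.units_eq_one_or (s j) with h | h
    · rw [if_pos h, if_pos h, h]
      have : SignType.sign (((1 : ℤˣ) : ℤ)) = 1 := rfl
      rw [this, sign_eq_one_iff]
      constructor
      · rintro ⟨h1, h2⟩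
        have h0 := (hA0 j).trans_le h1
        rw [abs_of_pos h0]
        exact ⟨h0, h1, h2⟩
      · rintro ⟨h0, h1, h2⟩
        rw [abs_of_pos h0] at h1 h2
        exact ⟨h1, h2⟩
    · have h' : s j ≠ 1 := by rw [h]; decide
      rw [if_neg h', if_neg h', h]
      have : SignType.sign (((-1 : ℤˣ) : ℤ)) = -1 := rfl
      rw [this, sign_eq_neg_one_iff]
      constructor
      · rintro ⟨h1, h2⟩
        have h0 : y < 0 := h2.trans_lt (neg_neg_of_pos (hA0 j))
        rw [abs_of_neg h0]
        exact ⟨h0, le_neg.1 h2, neg_le.1 h1⟩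
      · rintro ⟨h0, h1, h2⟩
        rw [abs_of_neg h0] at h1 h2
        exact ⟨neg_le.1 h2, le_neg.1 h1⟩
  rw [idealMatroid, mem_signedBergmanFan_ofSubspace_iff] at hw
  obtain ⟨x, hx, hxW⟩ := exists_orthogonal_mem_box (linearForms I) l u hlu fun a ha => by
    obtain ⟨v, hv⟩ := hconst.exists_val_eq ha
    have h := hw _ ((OrientedMatroid.ofSubspace (linearForms I)).neg_mem _ ⟨a, ha, rfl⟩)
    rw [initialCircuit_neg, signedSubset_iff] at h
    push Not at h
    obtain ⟨j, hj0, hj⟩ := h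
    have h3 : ∀ a b : SignType, -a ≠ 0 → b ≠ 0 → -a ≠ b → a = b := by decide
    have hs0 : pureSignVector s j ≠ 0 := by
      rw [pureSignVector, Ne, sign_eq_zero_iff]
      exact (s j).isUnit.ne_zero
    have haj := h3 _ _ hj0 hs0 hj
    have hj0' : initialCircuit w (fun j => SignType.sign (a j)) j ≠ 0 := haj ▸ hs0
    rw [initialCircuit_apply_of_ne_zero hj0'] at haj
    have hj' := initialCircuit_sign_ne_zero_iff.1 hj0'
    -- The extreme points of the box with `|y i| = A i` and `|y i| = B i`.
    have hex : ∀ i, ∃ y : RealPuiseux × RealPuiseux,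
        (SignType.sign y.1 = pureSignVector s i ∧ |y.1| = A i) ∧
        (SignType.sign y.2 = pureSignVector s i ∧ |y.2| = B i) := by
      intro i
      rw [pureSignVector]
      rcases Int.units_eq_one_or (s i) with h | h
      · rw [h]
        exact ⟨(A i, B i), ⟨sign_pos (hA0 i), abs_of_pos (hA0 i)⟩,
          sign_pos (hB0 i), abs_of_pos (hB0 i)⟩
      · rw [h]
        exact ⟨(-A i, -B i), ⟨sign_neg (neg_neg_of_pos (hA0 i)), by rw [abs_neg, abs_of_pos (hA0 i)]⟩,
          sign_neg (neg_neg_of_pos (hB0 i)), by rw [abs_neg, abs_of_pos (hB0 i)]⟩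
    choose y hyA hyB using hex
    refine ⟨fun i => if i = j then (y i).2 else (y i).1, fun i => (hbox i _).2 ?_, ?_⟩
    · dsimp only
      split_ifs
      · exact ⟨(hyB i).1, (hyB i).2 ▸ (hAB i).le, (hyB i).2.le⟩
      · exact ⟨(hyA i).1, (hyA i).2.ge, (hyA i).2 ▸ (hAB i).le⟩
    · have hy2 : (y j).2 ≠ 0 := abs_pos.1 ((hyB j).2 ▸ hB0 j)
      have hpos : 0 < a j * (y j).2 := by
        rw [← sign_eq_one_iff, sign_mul, haj, ← (hyB j).1, ← sign_mul, sign_eq_one_iff]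
        exact mul_self_pos.2 hy2
      refine (sum_pos_of_forall_neg_val_lt _ (j := j) (by simpa using hpos) fun i hneg => ?_).le
      beta_reduce at hneg ⊢
      by_cases hij : i = j
      · subst hij
        rw [if_pos rfl] at hneg
        exact absurd hneg hpos.not_gt
      rw [if_neg hij] at hneg
      rw [if_pos rfl, if_neg hij]
      have hai : a i ≠ 0 := left_ne_zero_of_mul hneg.ne
      rw [val_mul hj'.1 hy2, val_mul hai (right_ne_zero_of_mul hneg.ne), hv j hj'.1, hv i hai,
        ← val_abs (y j).2, ← val_abs (y i).1, (hyB j).2, (hyA i).2, hA, hB]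
      push_cast
      linarith [hj'.2 i hai, (hlo i).2, (hhi j).1]
  have hx' := fun j => (hbox j _).1 (hx j)
  have hx0 : ∀ j, x j ≠ 0 := fun j => abs_pos.1 ((hA0 j).trans_le (hx' j).2.1)
  refine ⟨fun j => Units.mk0 (x j) (hx0 j), (mem_variety_iff_of_isLinearIdeal hlin _).2 hxW,
    fun j => ⟨?_, ?_⟩⟩
  · have hinj : ∀ a b : ℤˣ, SignType.sign (a : ℤ) = SignType.sign (b : ℤ) → a = b := by decide
    exact hinj _ _ ((sign_sgn _).trans (hx' j).1)
  · have h1 := val_le_val_of_abs_le (hA0 j).ne' (hx0 j)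
      (by rw [abs_of_pos (hA0 j)]; exact (hx' j).2.1)
    have h2 := val_le_val_of_abs_le (hx0 j) (hB0 j).ne'
      (by rw [abs_of_pos (hB0 j)]; exact (hx' j).2.2)
    rw [hA] at h1
    rw [hB] at h2
    push_cast at h1 h2
    rw [Units.val_mk0, abs_lt]
    constructor <;> linarith [(hlo j).1, (hhi j).2]

/-! ### Real tropicalization of linear ideals -/

theorem isOpen_chart {n : ℕ} (s : Fin n → ℤˣ) : IsOpen (chart s) := by
  simp only [chart, Set.ofPred_forall]
  exact isOpen_iInter_of_finite fun j =>
    (isOpen_discrete {s j}).preimage (continuous_fst.comp (continuous_apply j))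

theorem continuous_toChart {n : ℕ} (s : Fin n → ℤˣ) : Continuous (toChart s) :=
  continuous_pi fun j => continuous_const.prodMk (continuous_apply j)

end RealTropical

theorem mainTheorem2 {n : ℕ} (I : Ideal (RealTropical.LaurentRing n))
    (hlin : RealTropical.IsLinearIdeal I)
    (hconst : RealTropical.HasConstantCoefficients I)
    (s : Fin n → ℤˣ) :
    RealTropical.realTropicalization (RealTropical.variety I) ∩ RealTropical.chart s =
      RealTropical.toChart s '' RealTropical.signedBergmanFan s (RealTropical.idealMatroid I) := by
  open RealTropical in
  refine Set.Subset.antisymm ?_ ?_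
  · rintro y ⟨hy, hys⟩
    refine ⟨fun j => (y j).2, ?_, funext fun j => Prod.ext (hys j).symm rfl⟩
    -- The chart is open, so `y` is a limit of points in the chart; and the fan is closed.
    have hy' : y ∈ closure (((fun x j => realTrop (x j)) '' variety I) ∩ chart s) :=
      (isOpen_chart s).closure_inter ⟨hy, hys⟩
    have hcont : Continuous fun (y : Fin n → RealTropicalGroup) j => (y j).2 :=
      continuous_pi fun j => continuous_snd.comp (continuous_apply j)
    refine (isClosed_signedBergmanFan_ofSubspace (linearForms I) s).closure_eq ▸
      map_mem_closure hcont hy' ?_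
    rintro _ ⟨⟨x, hx, rfl⟩, hxs⟩
    obtain rfl : (fun j => sgn (x j)) = s := funext hxs
    exact mem_signedBergmanFan_of_mem_variety hlin hconst hx
  · rintro _ ⟨w, hw, rfl⟩
    refine ⟨?_, fun _ => rfl⟩
    have hcl : w ∈ closure {w' | toChart s w' ∈ (fun x j => realTrop (x j)) '' variety I} := by
      refine Metric.mem_closure_iff.2 fun ε hε => ?_
      obtain ⟨x, hx, hxw⟩ := exists_mem_variety_near hlin hconst hw hε
      refine ⟨fun j => -val (x j), ⟨x, hx, funext fun j => Prod.ext (hxw j).1 rfl⟩, ?_⟩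
      rw [dist_comm, dist_pi_lt_iff hε]
      exact fun j => (hxw j).2
    exact map_mem_closure (continuous_toChart s) hcl fun _ h => h
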